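/- Let $\tau : SU(2) \to U(H)$ be a strongly continuous irreducible unitary representation of $SU(2)$ on a finite-dimensional complex Hilbert space $H$ with $\dim H = n+1$, $n \in \mathbb{N}_0$. The determinant of $\tau$ is the subspace $$\det(\tau,H) = \{ \xi \in H \otimes H \mid (\tau(g) \otimes \tau(g))\xi = \xi \ \text{ for all } g \in SU(2) \}$$ of $H \otimes H$. Let $f_0, f_1$ be the standard basis of $\mathbb{C}^2$, let $L_n = (\mathbb{C}^2)^{\otimes_S n} \subseteq (\mathbb{C}^2)^{\otimes n}$ be the Hilbert space of symmetric tensors (those fixed by all permutations of the tensor factors), and let $\rho_n : SU(2) \to U(L_n)$ be the restriction to $L_n$ of the $n$-fold tensor product of the fundamental representation of $SU(2)$ on $\mathbb{C}^2$. For $k \in \{0,1,\ldots,n\}$ put $$e_k = \sqrt{\frac{n!}{k!(n-k)!}} \; p_n\big( f_0^{\otimes k} \otimes f_1^{\otimes (n-k)} \big) \in L_n,$$ where $p_n$ is the orthogonal projection of $(\mathbb{C}^2)^{\otimes n}$ onto $L_n$. Then $\det(\tau,H)$ is one-dimensional. Moreover, for every unitary operator $V : L_n \to H$ with $V \rho_n(g)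 = \tau(g) V$ for all $g \in SU(2)$, the space $\det(\tau,H)$ is spanned by the vector $$(V \otimes V)\Big( (n+1)^{-1/2} \sum_{k=0}^n (-1)^{n-k} e_k \otimes e_{n-k} \Big).$$ -/

import Mathlib

open scoped TensorProduct

noncomputable section

namespace SUTwo

/-- The Lie group `SU(2)`, with the topology inherited from the `2 × 2` complex matrices. -/
abbrev SU2 : Type := Matrix.specialUnitaryGroup (Fin 2) ℂ

/-- The Hilbert space `ℂ²`. -/
abbrev C2 : Type := EuclideanSpace ℂ (Fin 2)

/-- The standard orthonormal basis `f₀, f₁` of `ℂ²`. -/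
def f (i : Fin 2) : C2 := EuclideanSpace.single i 1

/-! ### Unitary representations -/

section Rep

variable {H : Type*} [NormedAddCommGroup H] [InnerProductSpace ℂ H]

/-- The linear representation underlying a homomorphism from `SU(2)` into the group of unitary
operators `U(H)`, i.e. of surjective linear isometries of `H`. -/
def toRep (τ : SU2 →* (H ≃ₗᵢ[ℂ] H)) : Representation ℂ SU2 H where
  toFun g := (τ g).toLinearEquiv.toLinearMap
  map_one' := by ext x; simp
  map_mul' g h := by ext x; simp

/-- Strong continuity of a unitary representation. -/
def IsStronglyContinuous (τ : SU2 →* (H ≃ₗᵢ[ℂ] H)) : Prop :=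
  ∀ ξ : H, Continuous fun g : SU2 => τ g ξ

/-- Irreducibility: `H` is nonzero and has no invariant subspaces except `0` and `H`
(for finite-dimensional `H` all subspaces are closed). -/
def IsIrreducible (τ : SU2 →* (H ≃ₗᵢ[ℂ] H)) : Prop :=
  (toRep τ).IsIrreducible

/-- The determinant of `H` with respect to `τ`: the subspace of `H ⊗ H` of vectors fixed by
`τ g ⊗ τ g` for all `g` in `SU(2)`. -/
def determinant (τ : SU2 →* (H ≃ₗᵢ[ℂ] H)) : Submodule ℂ (H ⊗[ℂ] H) where
  carrier := {ξ | ∀ g : SU2, TensorProduct.map (toRep τ g) (toRep τ g) ξ = ξ}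
  add_mem' := fun {x y} hx hy g => by rw [map_add, hx g, hy g]
  zero_mem' := fun g => map_zero _
  smul_mem' := fun c x hx g => by rw [map_smul, hx g]

end Rep

/-! ### The Hilbert space `(ℂ²)^{⊗ n}` -/

/-- The `n`-fold tensor power `(ℂ²)^{⊗ n}`. A type synonym, since it carries the Hilbert space
norm. -/
def TensorPow (n : ℕ) : Type := ⨂[ℂ] _ : Fin n, C2

instance (n : ℕ) : AddCommGroup (TensorPow n) :=
  inferInstanceAs (AddCommGroup (⨂[ℂ] _ : Fin n, C2))

instance (n : ℕ) : Module ℂ (TensorPow n) :=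
  inferInstanceAs (Module ℂ (⨂[ℂ] _ : Fin n, C2))

/-- The elementary tensor `x₁ ⊗ ⋯ ⊗ xₙ`. -/
def elem {n : ℕ} (x : Fin n → C2) : TensorPow n := PiTensorProduct.tprod ℂ x

/-- The coordinates of a tensor in the basis `f_{i₁} ⊗ ⋯ ⊗ f_{iₙ}`. -/
def coords (n : ℕ) : TensorPow n ≃ₗ[ℂ] EuclideanSpace ℂ (Fin n → Fin 2) :=
  (Basis.piTensorProduct fun _ : Fin n => (EuclideanSpace.basisFun (Fin 2) ℂ).toBasis).equivFun ≪≫ₗ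
    (WithLp.linearEquiv 2 ℂ ((Fin n → Fin 2) → ℂ)).symm

theorem coords_elem {n : ℕ} (x : Fin n → C2) (p : Fin n → Fin 2) :
    coords n (elem x) p = ∏ i, x i (p i) := by
  change (Basis.piTensorProduct fun _ : Fin n =>
    (EuclideanSpace.basisFun (Fin 2) ℂ).toBasis).repr (PiTensorProduct.tprod ℂ x) p = _
  simp

instance (n : ℕ) : NormedAddCommGroup (TensorPow n) :=
  NormedAddCommGroup.induced _ _ (coords n).toLinearMap (coords n).injective

/-- The tensor product inner product; it is the one determined by `inner_elem` below. -/
instance (n : ℕ) : InnerProductSpace ℂ (TensorPow n) where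
  norm_smul_le c x := by
    change ‖coords n (c • x)‖ ≤ ‖c‖ * ‖coords n x‖
    rw [map_smul, norm_smul]
  inner x y := inner ℂ (coords n x) (coords n y)
  norm_sq_eq_re_inner x := by
    change ‖coords n x‖ ^ 2 = _
    exact norm_sq_eq_re_inner (𝕜 := ℂ) _
  conj_inner_symm x y := inner_conj_symm _ _
  add_left x y z := by rw [map_add, inner_add_left]
  smul_left x y c := by rw [map_smul, inner_smul_left]

instance (n : ℕ) : FiniteDimensional ℂ (TensorPow n) :=
  (coords n).symm.finiteDimensional

theorem inner_elem {n : ℕ} (x y : Fin n → C2) :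
    inner ℂ (elem x) (elem y) = ∏ i, inner ℂ (x i) (y i) := by
  change inner ℂ (coords n (elem x)) (coords n (elem y)) = _
  simp only [PiLp.inner_apply, coords_elem]
  rw [Finset.prod_univ_sum, Fintype.piFinset_univ]
  simp [map_prod, Finset.prod_mul_distrib]

theorem span_elem (n : ℕ) : Submodule.span ℂ (Set.range (elem (n := n))) = ⊤ :=
  PiTensorProduct.span_tprod_eq_top

/-! ### Symmetric tensors and the representations `ρₙ` -/

/-- The action of a permutation, `x₁ ⊗ ⋯ ⊗ xₙ ↦ x_{σ⁻¹(1)} ⊗ ⋯ ⊗ x_{σ⁻¹(n)}`. -/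
def permute {n : ℕ} (σ : Equiv.Perm (Fin n)) : TensorPow n →ₗ[ℂ] TensorPow n :=
  (PiTensorProduct.reindex ℂ (fun _ : Fin n => C2) σ).toLinearMap

theorem permute_elem {n : ℕ} (σ : Equiv.Perm (Fin n)) (x : Fin n → C2) :
    permute σ (elem x) = elem fun i => x (σ⁻¹ i) :=
  PiTensorProduct.reindex_tprod σ x

/-- The symmetric tensor power `Lₙ = (ℂ²)^{⊗_S n}`, a subspace of `(ℂ²)^{⊗ n}`. -/
def symmetricTensors (n : ℕ) : Submodule ℂ (TensorPow n) where
  carrier := {ξ | ∀ σ : Equiv.Perm (Fin n), permute σ ξ = ξ}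
  add_mem' := fun {x y} hx hy σ => by rw [map_add, hx σ, hy σ]
  zero_mem' := fun σ => map_zero _
  smul_mem' := fun c x hx σ => by rw [map_smul, hx σ]

/-- The Hilbert space `Lₙ`, with the inner product of `(ℂ²)^{⊗ n}`. -/
abbrev L (n : ℕ) : Type := symmetricTensors n

/-- The fundamental representation of `SU(2)` on `ℂ²`, as a map on vectors. -/
def fund (g : SU2) : C2 →ₗ[ℂ] C2 := Matrix.toEuclideanLin (g : Matrix (Fin 2) (Fin 2) ℂ)

theorem fund_one : fund 1 = LinearMap.id := by
  ext x; simp [fund]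

theorem fund_mul (g h : SU2) : fund (g * h) = fund g ∘ₗ fund h := by
  ext x : 1
  simp [fund, Matrix.toLpLin_apply]

theorem inner_fund (g : SU2) (x y : C2) : inner ℂ (fund g x) (fund g y) = inner ℂ x y := by
  have hg : star (g : Matrix (Fin 2) (Fin 2) ℂ) * g = 1 :=
    (Matrix.mem_unitaryGroup_iff').1 (Matrix.specialUnitaryGroup_le_unitaryGroup g.2)
  have : inner ℂ (fund g x) (fund g y)
      = inner ℂ x (Matrix.toEuclideanLin (star (g : Matrix (Fin 2) (Fin 2) ℂ)) (fund g y)) := by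
    rw [Matrix.star_eq_conjTranspose, Matrix.toEuclideanLin_conjTranspose_eq_adjoint,
      LinearMap.adjoint_inner_right]
    rfl
  rw [this]
  congr 1
  simp only [fund, Matrix.toLpLin_apply, Matrix.mulVec_mulVec, hg, Matrix.one_mulVec]

/-- The `n`-fold tensor product of the fundamental representation. -/
def tensorFund (n : ℕ) (g : SU2) : TensorPow n →ₗ[ℂ] TensorPow n :=
  PiTensorProduct.map (R := ℂ) (s := fun _ : Fin n => C2) (t := fun _ : Fin n => C2)
    fun _ => fund g

theorem tensorFund_elem {n : ℕ} (g : SU2) (x : Fin n → C2) :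
    tensorFund n g (elem x) = elem fun i => fund g (x i) :=
  PiTensorProduct.map_tprod _ _

theorem hom_ext {n : ℕ} {M : Type*} [AddCommGroup M] [Module ℂ M] {A B : TensorPow n →ₗ[ℂ] M}
    (h : ∀ x, A (elem x) = B (elem x)) : A = B :=
  LinearMap.ext_on_range (span_elem n) h

theorem tensorFund_one (n : ℕ) : tensorFund n 1 = LinearMap.id :=
  hom_ext fun x => by simp [tensorFund_elem, fund_one]

theorem tensorFund_mul (n : ℕ) (g h : SU2) :
    tensorFund n (g * h) = tensorFund n g ∘ₗ tensorFund n h :=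
  hom_ext fun x => by simp [tensorFund_elem, fund_mul]

theorem tensorFund_permute {n : ℕ} (g : SU2) (σ : Equiv.Perm (Fin n)) (ξ : TensorPow n) :
    permute σ (tensorFund n g ξ) = tensorFund n g (permute σ ξ) := by
  have : permute σ ∘ₗ tensorFund n g = tensorFund n g ∘ₗ permute σ :=
    hom_ext fun x => by simp [tensorFund_elem, permute_elem]
  exact LinearMap.congr_fun this ξ

theorem inner_tensorFund {n : ℕ} (g : SU2) (ξ η : TensorPow n) :
    inner ℂ (tensorFund n g ξ) (tensorFund n g η) = inner ℂ ξ η := by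
  have hξ : ξ ∈ Submodule.span ℂ (Set.range (elem (n := n))) := span_elem n ▸ Submodule.mem_top
  have hη : η ∈ Submodule.span ℂ (Set.range (elem (n := n))) := span_elem n ▸ Submodule.mem_top
  induction hξ using Submodule.span_induction with
  | zero => simp
  | add a b _ _ ha hb => simp [ha, hb]
  | smul c a _ ha => simp [ha]
  | mem a ha =>
    obtain ⟨x, rfl⟩ := ha
    induction hη using Submodule.span_induction with
    | zero => simp
    | add a b _ _ ha hb => simp [ha, hb]
    | smul c a _ ha => simp [ha]
    | mem b hb =>
      obtain ⟨y, rfl⟩ := hb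
      simp [tensorFund_elem, inner_elem, inner_fund]

theorem tensorFund_mem {n : ℕ} (g : SU2) {ξ : TensorPow n} (hξ : ξ ∈ symmetricTensors n) :
    tensorFund n g ξ ∈ symmetricTensors n := fun σ => by
  rw [tensorFund_permute, hξ σ]

/-- The restriction of the `n`-fold tensor product of the fundamental representation to `Lₙ`,
as a unitary operator. -/
def rhoOp (n : ℕ) (g : SU2) : L n ≃ₗᵢ[ℂ] L n :=
  LinearEquiv.isometryOfInner
    (LinearEquiv.ofLinearMap
      ((tensorFund n g).restrict fun _ h => tensorFund_mem g h)
      ((tensorFund n g⁻¹).restrict fun _ h => tensorFund_mem g⁻¹ h)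
      (by
        ext ξ
        have := LinearMap.congr_fun (tensorFund_mul n g g⁻¹) ξ
        simpa [tensorFund_one] using this.symm)
      (by
        ext ξ
        have := LinearMap.congr_fun (tensorFund_mul n g⁻¹ g) ξ
        simpa [tensorFund_one] using this.symm))
    (fun ξ η => inner_tensorFund g (ξ : TensorPow n) η)

theorem coe_rhoOp {n : ℕ} (g : SU2) (ξ : L n) :
    (rhoOp n g ξ : TensorPow n) = tensorFund n g ξ := rfl

/-- The unitary representation `ρₙ : SU(2) → U(Lₙ)`. -/
def rho (n : ℕ) : SU2 →* (L n ≃ₗᵢ[ℂ] L n) where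
  toFun := rhoOp n
  map_one' := by
    ext ξ
    simp [coe_rhoOp, tensorFund_one]
  map_mul' g h := by
    ext ξ
    simp [coe_rhoOp, tensorFund_mul]

/-! ### The vectors `e_k` and the invariant vector -/

/-- `f₀^k f₁^{n-k}`: the orthogonal projection onto `Lₙ` of `f₀^{⊗ k} ⊗ f₁^{⊗ (n-k)}`,
where `0 ≤ k ≤ n`. -/
def monomialVec (n k : ℕ) : L n :=
  (symmetricTensors n).orthogonalProjectionOnto
    (elem fun i : Fin n => if (i : ℕ) < k then f 0 else f 1)

/-- `e_k = √(n! / (k! (n-k)!)) · f₀^k f₁^{n-k}`, where `0 ≤ k ≤ n`. -/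
def e (n k : ℕ) : L n :=
  ((Real.sqrt ((n.factorial : ℝ) / (k.factorial * (n - k).factorial)) : ℝ) : ℂ) • monomialVec n k

/-- The vector `(n+1)^{-1/2} ∑_{k=0}^n (-1)^{n-k} e_k ⊗ e_{n-k}` in `Lₙ ⊗ Lₙ`. -/
def delta (n : ℕ) : L n ⊗[ℂ] L n :=
  (((Real.sqrt ((n : ℝ) + 1))⁻¹ : ℝ) : ℂ) •
    ∑ k ∈ Finset.range (n + 1), ((-1 : ℂ) ^ (n - k)) • (e n k ⊗ₜ[ℂ] e n (n - k))

/-- `V : Lₙ → H` is a unitary operator intertwining `ρₙ` and `τ`. -/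
def Intertwines {H : Type*} [NormedAddCommGroup H] [InnerProductSpace ℂ H] {n : ℕ}
    (V : L n ≃ₗᵢ[ℂ] H) (τ : SU2 →* (H ≃ₗᵢ[ℂ] H)) : Prop :=
  ∀ (g : SU2) (ξ : L n), V (rho n g ξ) = τ g (V ξ)

end SUTwo

end

open scoped TensorProduct

noncomputable section

namespace SUTwo

open MeasureTheory

/-! In an orthonormal basis with matrix coefficients M, a vector of `H ⊗ H` is a matrix c, and it
lies in the determinant iff M(g) c M(g)ᵀ = c for all g.

Existence of a nonzero c: every element of SU(2) is conjugate to its inverse (`isConj_inv`), so the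
character χ is real. Haar averages of matrix units are invariant, and if all of them vanished then ∫
χ² = ∫ |χ|² would be 0, although χ(1) ≠ 0 (`exists_invariant_matrix`). Uniqueness up to scalar is
Schur's lemma: an invariant matrix is zero or invertible (`isUnit_of_invariant`), and for c ≠ 0 some
z • c - d is singular.

The explicit vector comes from f₀ ⊗ f₁ - f₁ ⊗ f₀, which SU(2) fixes because det g = 1. Its n-th
tensor power `omega` is invariant, and projecting both legs onto symmetric tensors, which commutes
with the action, gives `delta` up to normalization (`delta_eq`). As `delta` is nonzero and V ⊗ V is
an injective intertwiner, its image spans the line. -/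

/-- Averaging the rank one matrices over a compact group of matrices with real character yields a
nonzero invariant bilinear form. -/
theorem exists_invariant_matrix {G ι : Type*} [Group G] [TopologicalSpace G] [IsTopologicalGroup G]
    [CompactSpace G] [Fintype ι] [DecidableEq ι] [Nonempty ι] (M : G →* Matrix ι ι ℂ)
    (hM : Continuous M) (hreal : ∀ g, star (M g).trace = (M g).trace) :
    ∃ c : Matrix ι ι ℂ, c ≠ 0 ∧ ∀ g, M g * c * (M g).transpose = c := by
  let _ : MeasurableSpace G := borel G
  have : BorelSpace G := ⟨rfl⟩
  let μ : Measure G := Measure.haar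
  have hent : ∀ i j, Continuous fun g => M g i j := fun i j => hM.matrix_elem i j
  have hint : ∀ F : G → ℂ, Continuous F → Integrable F μ := fun F hF =>
    hF.integrable_of_hasCompactSupport (HasCompactSupport.of_compactSpace F)
  let c : ι → ι → Matrix ι ι ℂ := fun j l => Matrix.of fun i k => ∫ g, M g i j * M g k l ∂μ
  have hinv : ∀ j l g, M g * c j l * (M g).transpose = c j l := by
    intro j l h
    ext p q
    have h1 : (M h * c j l * (M h).transpose) p q
        = ∫ g, ∑ k, (∑ i, M h p i * (M g i j * M g k l)) * M h q k ∂μ := by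
      rw [integral_finsetSum _ fun k _ => hint _ (by fun_prop)]
      simp only [Matrix.mul_apply, Matrix.transpose_apply]
      refine Finset.sum_congr rfl fun k _ => ?_
      rw [integral_mul_const, integral_finsetSum _ fun i _ => hint _ (by fun_prop)]
      simp only [integral_const_mul]
      rfl
    rw [h1]
    have h2 : ∀ g, ∑ k, (∑ i, M h p i * (M g i j * M g k l)) * M h q k
        = M (h * g) p j * M (h * g) q l := by
      intro g
      simp only [map_mul, Matrix.mul_apply, Finset.sum_mul, Finset.mul_sum]
      refine Finset.sum_congr rfl fun k _ => Finset.sum_congr rfl fun i _ => by ring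
    simp only [h2]
    -- Left invariance of Haar measure under g ↦ h * g.
    exact integral_mul_left_eq_self (fun g => M g p j * M g q l) h
  by_contra! hne
  have hz : ∀ j l, c j l = 0 := fun j l => by
    by_contra h0
    obtain ⟨g, hg⟩ := hne _ h0
    exact hg (hinv j l g)
  -- The (j, l) entry of `c j l` is ∫ M_jj M_ll; summing over j and l gives ∫ χ².
  have htr : ∫ g, (M g).trace * (M g).trace ∂μ = 0 := by
    have : ∀ g, (M g).trace * (M g).trace = ∑ j, ∑ l, M g j j * M g l l := fun g => by
      simp [Matrix.trace, Finset.sum_mul_sum]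
    simp only [this]
    rw [integral_finsetSum _ fun k _ => hint _ (by fun_prop)]
    refine Finset.sum_eq_zero fun j _ => ?_
    rw [integral_finsetSum _ fun k _ => hint _ (by fun_prop)]
    refine Finset.sum_eq_zero fun l _ => ?_
    exact congrFun (congrFun (hz j l) j) l
  have hsq : ∀ g, (M g).trace * (M g).trace = ((‖(M g).trace‖ ^ 2 : ℝ) : ℂ) := fun g => by
    have := Complex.conj_mul' (M g).trace
    rw [← RCLike.star_def, hreal g] at this
    simpa using this
  simp only [hsq] at htr
  rw [integral_complex_ofReal, Complex.ofReal_eq_zero] at htr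
  have hcont : Continuous fun g => ‖(M g).trace‖ ^ 2 := by
    have : Continuous fun g => (M g).trace := hM.matrix_trace
    fun_prop
  -- The integrand is continuous, nonnegative and nonzero at 1, where the trace is the size of the
  -- matrix.
  have hpos : 0 < ∫ g, ‖(M g).trace‖ ^ 2 ∂μ :=
    hcont.integral_pos_of_hasCompactSupport_nonneg_nonzero (HasCompactSupport.of_compactSpace _)
      (fun g => by positivity) (x := 1) (by simp)
  exact hpos.ne' htr

/-! ### The group `SU(2)` -/

instance : IsTopologicalGroup SU2 where
  continuous_mul := continuous_mul
  continuous_inv := by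
    have : Continuous fun g : SU2 => star (g : Matrix (Fin 2) (Fin 2) ℂ) :=
      continuous_star.comp continuous_subtype_val
    exact this.subtype_mk _

instance : CompactSpace SU2 := by
  refine isCompact_iff_compactSpace.1 ?_
  have hbox : IsCompact {A : Matrix (Fin 2) (Fin 2) ℂ | ∀ i j, A i j ∈ Metric.closedBall 0 1} := by
    have := isCompact_univ_pi fun _ : Fin 2 => isCompact_univ_pi fun _ : Fin 2 =>
      isCompact_closedBall (0 : ℂ) 1
    simp only [Set.pi, Set.mem_univ, true_imp_iff] at this
    exact this
  refine hbox.of_isClosed_subset ?_ fun A hA i j => ?_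
  · have : (Matrix.specialUnitaryGroup (Fin 2) ℂ : Set (Matrix (Fin 2) (Fin 2) ℂ))
        = {A | A * star A = 1} ∩ {A | A.det = 1} := by
      ext A
      simp [Matrix.mem_specialUnitaryGroup_iff, Matrix.mem_unitaryGroup_iff]
    rw [this]
    exact (isClosed_eq (by fun_prop) continuous_const).inter
      (isClosed_eq (continuous_id.matrix_det) continuous_const)
  · simpa using entry_norm_bound_of_unitary (Matrix.specialUnitaryGroup_le_unitaryGroup hA) i j

/-- For A in SU(2) the inverse is the adjugate. Conjugation by an antidiagonal matrix swaps the
diagonal entries; a suitable phase c in it corrects the off-diagonal ones. -/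
theorem isConj_inv (g : SU2) : IsConj g g⁻¹ := by
  obtain ⟨A, hA⟩ := g
  have hU := (Matrix.mem_specialUnitaryGroup_iff.1 hA).1
  have hadj : star A = A.adjugate := by
    have h1 : A * star A = 1 := Matrix.mem_unitaryGroup_iff.1 hU
    have h2 : A.adjugate * A = 1 := by
      rw [Matrix.adjugate_mul, (Matrix.mem_specialUnitaryGroup_iff.1 hA).2, one_smul]
    calc star A = (A.adjugate * A) * star A := by rw [h2, one_mul]
      _ = A.adjugate := by rw [mul_assoc, h1, mul_one]
  have e00 : A 1 1 = star (A 0 0) := by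
    have := congrFun (congrFun hadj 0) 0
    simpa [Matrix.adjugate_fin_two] using this.symm
  have e01 : A 0 1 = -star (A 1 0) := by
    have := congrFun (congrFun hadj 0) 1
    simp [Matrix.adjugate_fin_two] at this
    simp [this]
  -- With b = A 1 0, the phase must make star c * b purely imaginary: c = i b / |b|, or anything
  -- unimodular if b = 0.
  obtain ⟨c, hc, hcb⟩ : ∃ c : ℂ, c * star c = 1 ∧ star c * A 1 0 + c * star (A 1 0) = 0 := by
    by_cases hb : A 1 0 = 0
    · exact ⟨1, by simp, by simp [hb]⟩
    · have hb' : (‖A 1 0‖ : ℂ) ≠ 0 := by simpa using hb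
      have hn : A 1 0 * star (A 1 0) = (‖A 1 0‖ : ℂ) ^ 2 := Complex.mul_conj' _
      refine ⟨Complex.I * A 1 0 / ‖A 1 0‖, ?_, ?_⟩
      · simp only [star_div₀, star_mul', RCLike.star_def, Complex.conj_I, Complex.conj_ofReal] at hn ⊢
        field_simp
        linear_combination (-Complex.I ^ 2) * hn + (-(‖A 1 0‖ : ℂ) ^ 2) * Complex.I_sq
      · simp only [star_div₀, star_mul', RCLike.star_def, Complex.conj_I, Complex.conj_ofReal]
        ring
  let B : Matrix (Fin 2) (Fin 2) ℂ := !![0, -star c; c, 0]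
  have hB : B ∈ Matrix.specialUnitaryGroup (Fin 2) ℂ := by
    rw [Matrix.mem_specialUnitaryGroup_iff, Matrix.mem_unitaryGroup_iff]
    have hc' : star c * c = 1 := by rw [mul_comm]; exact hc
    constructor
    · ext i j
      fin_cases i <;> fin_cases j <;>
        simp [B, Matrix.mul_apply, Matrix.star_eq_conjTranspose] <;>
        first | exact hc' | exact hc
    · simpa [B, Matrix.det_fin_two] using hc'
  rw [isConj_iff]
  refine ⟨⟨B, hB⟩, mul_inv_eq_iff_eq_mul.2 (Subtype.ext ?_)⟩
  change B * A = star A * B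
  rw [hadj]
  ext i j
  fin_cases i <;> fin_cases j <;>
    simp [B, Matrix.mul_apply, Matrix.adjugate_fin_two, e00, e01] <;>
    simp only [RCLike.star_def] at hcb
  · linear_combination -hcb
  · ring
  · ring
  · linear_combination -hcb

/-! ### Invariant vectors in `H ⊗ H` as matrices -/

section TensorMatrix

variable {R M ι : Type*} [CommRing R] [AddCommGroup M] [Module R M] [Fintype ι]

/-- The matrix of coordinates of a tensor in `M ⊗ M`. -/
def tensorMatrix (b : Module.Basis ι R M) : M ⊗[R] M ≃ₗ[R] Matrix ι ι R :=
  (b.tensorProduct b).equivFun ≪≫ₗ LinearEquiv.curry R R ι ι ≪≫ₗ Matrix.ofLinearEquiv R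

theorem tensorMatrix_tmul (b : Module.Basis ι R M) (x y : M) :
    tensorMatrix b (x ⊗ₜ y) = Matrix.vecMulVec (b.repr x) (b.repr y) := by
  ext i j
  simp [tensorMatrix, Matrix.vecMulVec_apply, mul_comm]

theorem tensorMatrix_map [DecidableEq ι] (b : Module.Basis ι R M) (φ ψ : M →ₗ[R] M) (ξ : M ⊗[R] M) :
    tensorMatrix b (TensorProduct.map φ ψ ξ)
      = LinearMap.toMatrix b b φ * tensorMatrix b ξ * (LinearMap.toMatrix b b ψ).transpose := by
  induction ξ with
  | zero => simp
  | add x y hx hy => simp [hx, hy, mul_add, add_mul]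
  | tmul x y =>
    rw [TensorProduct.map_tmul, tensorMatrix_tmul, tensorMatrix_tmul, Matrix.mul_vecMulVec,
      Matrix.vecMulVec_mul, Matrix.vecMul_transpose, LinearMap.toMatrix_mulVec_repr,
      LinearMap.toMatrix_mulVec_repr]

end TensorMatrix

/-! ### Schur's lemma for invariant matrices and the dimension of the determinant -/

section Det

variable {H : Type*} [NormedAddCommGroup H] [InnerProductSpace ℂ H]

variable {ι : Type*} [Fintype ι] [DecidableEq ι]

/-- The matrix form of a unitary representation. -/
def matrixRep (τ : SU2 →* (H ≃ₗᵢ[ℂ] H)) (b : OrthonormalBasis ι ℂ H) : SU2 →* Matrix ι ι ℂ :=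
  (LinearMap.toMatrixAlgEquiv b.toBasis : (H →ₗ[ℂ] H) →* Matrix ι ι ℂ).comp (toRep τ)

theorem matrixRep_eq_toMatrix (τ : SU2 →* (H ≃ₗᵢ[ℂ] H)) (b : OrthonormalBasis ι ℂ H) (g : SU2) :
    matrixRep τ b g = LinearMap.toMatrix b.toBasis b.toBasis (toRep τ g) := rfl

theorem matrixRep_apply (τ : SU2 →* (H ≃ₗᵢ[ℂ] H)) (b : OrthonormalBasis ι ℂ H) (g : SU2)
    (i j : ι) : matrixRep τ b g i j = inner ℂ (b i) (τ g (b j)) := by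
  rw [matrixRep_eq_toMatrix, LinearMap.toMatrix_apply, OrthonormalBasis.coe_toBasis,
    OrthonormalBasis.coe_toBasis_repr_apply, OrthonormalBasis.repr_apply_apply]
  rfl

theorem continuous_matrixRep {τ : SU2 →* (H ≃ₗᵢ[ℂ] H)} (hτ : IsStronglyContinuous τ)
    (b : OrthonormalBasis ι ℂ H) : Continuous (matrixRep τ b) := by
  refine continuous_matrix fun i j => ?_
  simp only [matrixRep_apply]
  exact continuous_const.inner (hτ (b j))

theorem matrixRep_inv (τ : SU2 →* (H ≃ₗᵢ[ℂ] H)) (b : OrthonormalBasis ι ℂ H) (g : SU2) :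
    matrixRep τ b g⁻¹ = (matrixRep τ b g).conjTranspose := by
  ext i j
  rw [Matrix.conjTranspose_apply, matrixRep_apply, matrixRep_apply, RCLike.star_def,
    inner_conj_symm, ← (τ g).inner_map_map (b i)]
  congr 1
  simp

/-- The character of a unitary representation of `SU(2)` is real, since every element of `SU(2)` is
conjugate to its inverse. -/
theorem star_trace_matrixRep (τ : SU2 →* (H ≃ₗᵢ[ℂ] H)) (b : OrthonormalBasis ι ℂ H) (g : SU2) :
    star (matrixRep τ b g).trace = (matrixRep τ b g).trace := by
  obtain ⟨h, hh⟩ := isConj_iff.1 (isConj_inv g)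
  rw [← Matrix.trace_conjTranspose, ← matrixRep_inv, ← hh, map_mul, Matrix.trace_mul_comm,
    ← map_mul, inv_mul_cancel_left]

theorem mem_determinant_iff_tensorMatrix {τ : SU2 →* (H ≃ₗᵢ[ℂ] H)} (b : OrthonormalBasis ι ℂ H)
    {ξ : H ⊗[ℂ] H} : ξ ∈ determinant τ ↔ ∀ g, matrixRep τ b g * tensorMatrix b.toBasis ξ *
      (matrixRep τ b g).transpose = tensorMatrix b.toBasis ξ := by
  simp only [matrixRep_eq_toMatrix, ← tensorMatrix_map, EmbeddingLike.apply_eq_iff_eq]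
  rfl

/-- A linear map whose range is invariant under an irreducible representation is zero or
surjective. -/
theorem IsIrreducible.surjective_or_eq_zero {τ : SU2 →* (H ≃ₗᵢ[ℂ] H)} (hτ : IsIrreducible τ)
    (D : H →ₗ[ℂ] H) (hD : ∀ g, ∃ D', toRep τ g ∘ₗ D = D ∘ₗ D') :
    Function.Surjective D ∨ D = 0 := by
  have : IsSimpleOrder (Subrepresentation (toRep τ)) := hτ
  let W : Subrepresentation (toRep τ) :=
    { toSubmodule := D.range
      apply_mem_toSubmodule := by
        rintro g _ ⟨x, rfl⟩
        obtain ⟨D', h⟩ := hD g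
        exact ⟨D' x, (LinearMap.congr_fun h x).symm⟩ }
  rcases eq_bot_or_eq_top W with h | h
  · right
    have h' : D.range = ⊥ := congrArg Subrepresentation.toSubmodule h
    exact LinearMap.range_eq_bot.1 h'
  · left
    have h' : D.range = ⊤ := congrArg Subrepresentation.toSubmodule h
    exact LinearMap.range_eq_top.1 h'

/-- Invariance rewrites as M(g) c = c M(g⁻¹)ᵀ, so the range of c is a subrepresentation. -/
theorem IsIrreducible.isUnit_of_invariant {τ : SU2 →* (H ≃ₗᵢ[ℂ] H)} (hτ : IsIrreducible τ)
    (b : OrthonormalBasis ι ℂ H) {c : Matrix ι ι ℂ}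
    (hc : ∀ g, matrixRep τ b g * c * (matrixRep τ b g).transpose = c) (h0 : c ≠ 0) :
    IsUnit c := by
  have : FiniteDimensional ℂ H := b.toBasis.finiteDimensional_of_finite
  have hD := hτ.surjective_or_eq_zero (Matrix.toLin b.toBasis b.toBasis c) fun g => by
    refine ⟨Matrix.toLin b.toBasis b.toBasis (matrixRep τ b g⁻¹).transpose, ?_⟩
    apply (LinearMap.toMatrix b.toBasis b.toBasis).injective
    rw [LinearMap.toMatrix_comp b.toBasis b.toBasis, LinearMap.toMatrix_comp b.toBasis b.toBasis,
      LinearMap.toMatrix_toLin, LinearMap.toMatrix_toLin, ← matrixRep_eq_toMatrix]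
    conv_rhs => rw [← hc g]
    rw [mul_assoc, mul_assoc, ← Matrix.transpose_mul, ← map_mul, inv_mul_cancel, map_one,
      Matrix.transpose_one, mul_one]
  rcases hD with h | h
  · have hu : IsUnit (Matrix.toLin b.toBasis b.toBasis c) :=
      (Module.End.isUnit_iff _).2 ⟨LinearMap.injective_iff_surjective.2 h, h⟩
    have := hu.map (LinearMap.toMatrixAlgEquiv b.toBasis)
    rwa [show LinearMap.toMatrixAlgEquiv b.toBasis (Matrix.toLin b.toBasis b.toBasis c) = c from
      LinearMap.toMatrix_toLin _ _ c] at this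
  · exact absurd ((Matrix.toLin b.toBasis b.toBasis).map_eq_zero_iff.1 h) h0

/-- Schur's argument: for z an eigenvalue of d c⁻¹, the matrix z • c - d is again invariant but not
invertible, hence zero. -/
theorem IsIrreducible.invariant_eq_smul [Nonempty ι] {τ : SU2 →* (H ≃ₗᵢ[ℂ] H)}
    (hτ : IsIrreducible τ) (b : OrthonormalBasis ι ℂ H) {c d : Matrix ι ι ℂ}
    (hc : ∀ g, matrixRep τ b g * c * (matrixRep τ b g).transpose = c) (h0 : c ≠ 0)
    (hd : ∀ g, matrixRep τ b g * d * (matrixRep τ b g).transpose = d) :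
    ∃ z : ℂ, z • c = d := by
  obtain ⟨u, rfl⟩ := hτ.isUnit_of_invariant b hc h0
  obtain ⟨z, hz⟩ := spectrum.nonempty_of_isAlgClosed_of_finiteDimensional ℂ
    (d * (↑u⁻¹ : Matrix ι ι ℂ))
  refine ⟨z, sub_eq_zero.1 ?_⟩
  by_contra hne
  have hu := hτ.isUnit_of_invariant b (c := z • (u : Matrix ι ι ℂ) - d) (fun g => by
    rw [mul_sub, sub_mul, hd, mul_smul_comm, smul_mul_assoc, hc]) hne
  refine hz ?_
  have := hu.mul u⁻¹.isUnit
  rwa [sub_mul, smul_mul_assoc, Units.mul_inv, ← Algebra.algebraMap_eq_smul_one] at this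

theorem finrank_determinant [FiniteDimensional ℂ H] {τ : SU2 →* (H ≃ₗᵢ[ℂ] H)}
    (hcont : IsStronglyContinuous τ) (hirr : IsIrreducible τ) :
    Module.finrank ℂ (determinant τ) = 1 := by
  have : Nontrivial H := by
    by_contra h
    rw [not_nontrivial_iff_subsingleton] at h
    obtain ⟨x, y, hxy⟩ := hirr.toNontrivial
    exact hxy (SetLike.ext fun v => by
      rw [Subsingleton.elim v 0]
      exact iff_of_true x.toSubmodule.zero_mem y.toSubmodule.zero_mem)
  let b := stdOrthonormalBasis ℂ H
  have : Nonempty (Fin (Module.finrank ℂ H)) := ⟨⟨0, Module.finrank_pos⟩⟩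
  obtain ⟨c, h0, hc⟩ := exists_invariant_matrix (matrixRep τ b) (continuous_matrixRep hcont b)
    (star_trace_matrixRep τ b)
  let E := tensorMatrix b.toBasis
  refine finrank_eq_one (⟨E.symm c, (mem_determinant_iff_tensorMatrix b).2 fun g => ?_⟩ :
    determinant τ) (fun h => h0 ?_) fun w => ?_
  · simpa [E] using hc g
  · exact E.symm.map_eq_zero_iff.1 (congrArg Subtype.val h)
  · obtain ⟨z, hz⟩ := hirr.invariant_eq_smul b hc h0 ((mem_determinant_iff_tensorMatrix b).1 w.2)
    refine ⟨z, Subtype.ext (E.injective ?_)⟩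
    simpa [E] using hz

end Det

/-! ### The symmetrization `(ℂ²)^{⊗ n} → Lₙ` -/

theorem inner_map_of_inner_map_elem {n : ℕ} {A : TensorPow n →ₗ[ℂ] TensorPow n}
    (h : ∀ x y, inner ℂ (A (elem x)) (A (elem y)) = inner ℂ (elem x) (elem y))
    (ξ η : TensorPow n) : inner ℂ (A ξ) (A η) = inner ℂ ξ η := by
  have hξ : ξ ∈ Submodule.span ℂ (Set.range (elem (n := n))) := span_elem n ▸ Submodule.mem_top
  have hη : η ∈ Submodule.span ℂ (Set.range (elem (n := n))) := span_elem n ▸ Submodule.mem_top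
  induction hξ, hη using Submodule.span_induction₂ with
  | mem_mem _ _ hx hy =>
    obtain ⟨x, rfl⟩ := hx
    obtain ⟨y, rfl⟩ := hy
    exact h x y
  | zero_left => simp
  | zero_right => simp
  | add_left _ _ _ _ _ _ h₁ h₂ => simp [h₁, h₂]
  | add_right _ _ _ _ _ _ h₁ h₂ => simp [h₁, h₂]
  | smul_left _ _ _ _ _ h => simp [h]
  | smul_right _ _ _ _ _ h => simp [h]

theorem inner_permute {n : ℕ} (σ : Equiv.Perm (Fin n)) (ξ η : TensorPow n) :
    inner ℂ (permute σ ξ) (permute σ η) = inner ℂ ξ η :=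
  inner_map_of_inner_map_elem (fun x y => by
    rw [permute_elem, permute_elem, inner_elem, inner_elem]
    exact Equiv.prod_comp σ⁻¹ fun i => inner ℂ (x i) (y i)) ξ η

/-- The orthogonal projection onto the symmetric tensors, as a linear map. -/
def symProj (n : ℕ) : TensorPow n →ₗ[ℂ] L n :=
  (symmetricTensors n).orthogonalProjectionOnto.toLinearMap

theorem inner_symProj {n : ℕ} (w : L n) (ξ : TensorPow n) :
    inner ℂ w (symProj n ξ) = inner ℂ (w : TensorPow n) ξ :=
  Submodule.inner_orthogonalProjectionOnto_eq_of_mem_left w ξ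

/-- Permutations act unitarily and fix every vector of `L n`, so they do not change inner products
against `L n`. -/
theorem symProj_permute {n : ℕ} (σ : Equiv.Perm (Fin n)) (ξ : TensorPow n) :
    symProj n (permute σ ξ) = symProj n ξ := by
  refine ext_inner_left ℂ fun w => ?_
  rw [inner_symProj, inner_symProj]
  conv_lhs => rw [← w.2 σ]
  exact inner_permute σ _ _

theorem symProj_tensorFund {n : ℕ} (g : SU2) (ξ : TensorPow n) :
    symProj n (tensorFund n g ξ) = rho n g (symProj n ξ) := by
  refine ext_inner_left ℂ fun w => ?_
  -- Testing against `rho n g w` lets unitarity cancel g on both sides.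
  obtain ⟨w, rfl⟩ := (rho n g).surjective w
  rw [LinearIsometryEquiv.inner_map_map, inner_symProj, inner_symProj]
  exact inner_tensorFund g _ _

/-- The number of tensor factors equal to `f₀` in `f_{s₁} ⊗ ⋯ ⊗ f_{sₙ}`. -/
def zeros {n : ℕ} (s : Fin n → Fin 2) : ℕ := (Finset.univ.filter fun i => s i = 0).card

theorem symProj_elem {n : ℕ} (s : Fin n → Fin 2) :
    symProj n (elem fun i => f (s i)) = monomialVec n (zeros s) := by
  have hz : zeros s ≤ n := by
    simpa [zeros] using Finset.card_le_univ (Finset.univ.filter fun i => s i = 0)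
  have hcard : Fintype.card {i : Fin n // (i : ℕ) < zeros s} = Fintype.card {i // s i = 0} := by
    rw [Fintype.card_subtype, Fintype.card_subtype, Fin.card_filter_val_lt, min_eq_right hz]
    rfl
  -- A permutation carrying the first `zeros s` positions onto those where s is 0; it sorts the
  -- factors f₀ to the front.
  let σ := (Fintype.equivOfCardEq hcard).extendSubtype
  have hσ : (permute σ⁻¹) (elem fun i => f (s i))
      = elem fun i : Fin n => if (i : ℕ) < zeros s then f 0 else f 1 := by
    rw [permute_elem]
    congr 1
    ext1 i
    rw [inv_inv]
    split_ifs with h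
    · have := Equiv.extendSubtype_mem (Fintype.equivOfCardEq hcard) i h
      rw [show s (σ i) = 0 by exact this]
    · have := Equiv.extendSubtype_not_mem (Fintype.equivOfCardEq hcard) i h
      rw [show s (σ i) = 1 by exact Fin.eq_one_of_ne_zero _ this]
  rw [← symProj_permute σ⁻¹, hσ]
  rfl

/-! ### The tensor power of the symplectic form -/

/-- The matrix of the symplectic form on `ℂ²`. -/
def eps : Matrix (Fin 2) (Fin 2) ℂ := !![0, 1; -1, 0]

/-- For any 2 × 2 matrix the left side is det g times `eps`. -/
theorem mul_eps_mul_transpose (g : SU2) :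
    (g : Matrix (Fin 2) (Fin 2) ℂ) * eps * (g : Matrix (Fin 2) (Fin 2) ℂ).transpose = eps := by
  have hdet := (Matrix.mem_specialUnitaryGroup_iff.1 g.2).2
  rw [Matrix.det_fin_two] at hdet
  ext i j
  fin_cases i <;> fin_cases j <;> simp [eps, Matrix.mul_apply, Fin.sum_univ_two]
  · ring
  · linear_combination hdet
  · linear_combination -hdet
  · ring

theorem fund_f (g : SU2) (j : Fin 2) :
    fund g (f j) = ∑ i, (g : Matrix (Fin 2) (Fin 2) ℂ) i j • f i := by
  ext k
  fin_cases k <;> simp [fund, f, Matrix.toLpLin_apply]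

theorem tensorFund_elem_f {n : ℕ} (g : SU2) (s : Fin n → Fin 2) :
    tensorFund n g (elem fun i => f (s i)) = ∑ u : Fin n → Fin 2,
      (∏ i, (g : Matrix (Fin 2) (Fin 2) ℂ) (u i) (s i)) • elem fun i => f (u i) := by
  rw [tensorFund_elem]
  simp only [fund_f]
  refine ((PiTensorProduct.tprod ℂ).map_sum
    (fun i a => (g : Matrix (Fin 2) (Fin 2) ℂ) a (s i) • f a)).trans ?_
  exact Finset.sum_congr rfl fun u _ => (PiTensorProduct.tprod ℂ).map_smul_univ _ _

/-- The `n`-th tensor power of `f₀ ⊗ f₁ - f₁ ⊗ f₀`, in `(ℂ²)^{⊗ n} ⊗ (ℂ²)^{⊗ n}`. -/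
def omega (n : ℕ) : TensorPow n ⊗[ℂ] TensorPow n :=
  ∑ s : Fin n → Fin 2, ∑ t : Fin n → Fin 2,
    (∏ i, eps (s i) (t i)) • ((elem fun i => f (s i)) ⊗ₜ[ℂ] elem fun i => f (t i))

theorem sum_comm_four {ι M : Type*} [Fintype ι] [AddCommMonoid M] (F : ι → ι → ι → ι → M) :
    ∑ s, ∑ t, ∑ v, ∑ u, F s t u v = ∑ u, ∑ v, ∑ s, ∑ t, F s t u v := by
  calc ∑ s, ∑ t, ∑ v, ∑ u, F s t u v = ∑ s, ∑ v, ∑ u, ∑ t, F s t u v :=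
        Finset.sum_congr rfl fun s _ => Finset.sum_comm.trans <|
          Finset.sum_congr rfl fun v _ => Finset.sum_comm
    _ = ∑ v, ∑ u, ∑ s, ∑ t, F s t u v :=
        Finset.sum_comm.trans <| Finset.sum_congr rfl fun v _ => Finset.sum_comm
    _ = ∑ u, ∑ v, ∑ s, ∑ t, F s t u v := Finset.sum_comm

/-- Coefficients of `omega` are products over the n factors, so invariance reduces factorwise to
`mul_eps_mul_transpose`. -/
theorem map_tensorFund_omega (n : ℕ) (g : SU2) :
    TensorProduct.map (tensorFund n g) (tensorFund n g) (omega n) = omega n := by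
  have hcoef : ∀ u v : Fin n → Fin 2,
      ∑ s : Fin n → Fin 2, ∑ t : Fin n → Fin 2, (∏ i, eps (s i) (t i)) *
        ((∏ i, (g : Matrix (Fin 2) (Fin 2) ℂ) (u i) (s i)) *
          ∏ i, (g : Matrix (Fin 2) (Fin 2) ℂ) (v i) (t i)) = ∏ i, eps (u i) (v i) := by
    intro u v
    have h : ∀ a b : Fin 2, eps a b = ∑ p, ∑ q, eps p q *
        ((g : Matrix (Fin 2) (Fin 2) ℂ) a p * (g : Matrix (Fin 2) (Fin 2) ℂ) b q) := by
      intro a b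
      conv_lhs => rw [← mul_eps_mul_transpose g]
      simp only [Matrix.mul_apply, Matrix.transpose_apply, Finset.sum_mul]
      rw [Finset.sum_comm]
      exact Finset.sum_congr rfl fun p _ => Finset.sum_congr rfl fun q _ => by ring
    simp only [h (u _) (v _), Finset.prod_univ_sum, Fintype.piFinset_univ, Finset.prod_mul_distrib]
  simp only [omega, map_sum, map_smul, TensorProduct.map_tmul, tensorFund_elem_f,
    TensorProduct.sum_tmul, TensorProduct.tmul_sum, TensorProduct.smul_tmul_smul, Finset.smul_sum,
    smul_smul]
  refine Eq.trans ?_ (Finset.sum_congr rfl fun u _ => Finset.sum_congr rfl fun v _ =>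
    congrArg (· • ((elem fun i => f (u i)) ⊗ₜ[ℂ] elem fun i => f (v i))) (hcoef u v))
  simp only [Finset.sum_smul]
  rw [sum_comm_four]

/-! ### Collecting the symmetrized `omega` into `delta` -/

theorem sum_prod_eps_smul {n : ℕ} {M : Type*} [AddCommGroup M] [Module ℂ M] (s : Fin n → Fin 2)
    (F : ℕ → M) : ∑ t : Fin n → Fin 2, (∏ i, eps (s i) (t i)) • F (zeros t)
      = (-1 : ℂ) ^ (n - zeros s) • F (n - zeros s) := by
  have hcompl : (Finset.univ.filter fun i => ¬ s i = 0).card = n - zeros s := by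
    have := Finset.card_filter_add_card_filter_not (s := Finset.univ) fun i => s i = 0
    rw [Finset.card_univ, Fintype.card_fin] at this
    unfold zeros
    omega
  -- Since `eps` is antidiagonal, only the t that flips every entry of s contributes, with a sign -1
  -- for each entry 1 of s.
  rw [Finset.sum_eq_single fun i => Fin.rev (s i)]
  · congr 1
    · have : ∀ a : Fin 2, eps a a.rev = if a = 0 then 1 else -1 := by
        intro a; fin_cases a <;> simp [eps]
      simp only [this, Finset.prod_ite, Finset.prod_const_one, Finset.prod_const, one_mul, hcompl]
    · congr 1
      rw [← hcompl]
      unfold zeros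
      congr 1
      ext i
      have : ∀ a : Fin 2, a.rev = 0 ↔ ¬ a = 0 := by decide
      simp [this]
  · intro t _ ht
    obtain ⟨i, hi⟩ := Function.ne_iff.1 ht
    have : ∀ a b : Fin 2, b ≠ a.rev → eps a b = 0 := by
      intro a b; fin_cases a <;> fin_cases b <;> simp [eps]
    rw [Finset.prod_eq_zero (Finset.mem_univ i) (this _ _ hi), zero_smul]
  · simp

theorem sum_zeros {n : ℕ} {M : Type*} [AddCommGroup M] (F : ℕ → M) :
    ∑ s : Fin n → Fin 2, F (zeros s) = ∑ k ∈ Finset.range (n + 1), n.choose k • F k := by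
  have := Finset.sum_powerset_apply_card F (x := (Finset.univ : Finset (Fin n)))
  rw [Finset.card_univ, Fintype.card_fin] at this
  rw [← this]
  refine Finset.sum_bij' (fun s _ => Finset.univ.filter fun i => s i = 0)
    (fun S _ i => if i ∈ S then 0 else 1) (by simp) (by simp) ?_ ?_ ?_
  · intro s _
    ext1 i
    simp only [Finset.mem_filter, Finset.mem_univ, true_and]
    split_ifs with h
    · exact h.symm
    · exact (Fin.eq_one_of_ne_zero _ h).symm
  · intro S _
    ext i
    simp
  · intro s _
    rfl

/-- The normalizing square roots at k and n - k coincide, so their product is the binomial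
coefficient, which is also the number of s with k zeros in `sum_zeros`. -/
theorem e_tmul_e {n k : ℕ} (hk : k ≤ n) :
    e n k ⊗ₜ[ℂ] e n (n - k) = (n.choose k : ℂ) • (monomialVec n k ⊗ₜ[ℂ] monomialVec n (n - k)) := by
  rw [e, e, TensorProduct.smul_tmul_smul, Nat.sub_sub_self hk,
    mul_comm ((n - k).factorial : ℝ), ← Complex.ofReal_mul, Real.mul_self_sqrt (by positivity)]
  congr 1
  rw [Nat.cast_choose ℂ hk]
  push_cast
  rfl

theorem delta_eq (n : ℕ) : delta n = (((Real.sqrt ((n : ℝ) + 1))⁻¹ : ℝ) : ℂ) •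
    TensorProduct.map (symProj n) (symProj n) (omega n) := by
  rw [delta]
  congr 1
  have h : ∀ s : Fin n → Fin 2, ∑ t : Fin n → Fin 2, (∏ i, eps (s i) (t i)) •
      (monomialVec n (zeros s) ⊗ₜ[ℂ] monomialVec n (zeros t)) = (-1 : ℂ) ^ (n - zeros s) •
        (monomialVec n (zeros s) ⊗ₜ[ℂ] monomialVec n (n - zeros s)) := fun s =>
    sum_prod_eps_smul s fun k => monomialVec n (zeros s) ⊗ₜ[ℂ] monomialVec n k
  simp only [omega, map_sum, map_smul, TensorProduct.map_tmul, symProj_elem, h]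
  rw [sum_zeros fun k => (-1 : ℂ) ^ (n - k) • (monomialVec n k ⊗ₜ[ℂ] monomialVec n (n - k))]
  refine Finset.sum_congr rfl fun k hk => ?_
  rw [e_tmul_e (Nat.lt_succ_iff.1 (Finset.mem_range.1 hk)), smul_comm, Nat.cast_smul_eq_nsmul]

theorem delta_mem_determinant (n : ℕ) : delta n ∈ determinant (rho n) := by
  rw [delta_eq]
  refine Submodule.smul_mem _ _ fun g => ?_
  have hcomm : toRep (rho n) g ∘ₗ symProj n = symProj n ∘ₗ tensorFund n g :=
    LinearMap.ext fun ξ => (symProj_tensorFund g ξ).symm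
  rw [← LinearMap.comp_apply, ← TensorProduct.map_comp, hcomm, TensorProduct.map_comp,
    LinearMap.comp_apply, map_tensorFund_omega]

/-! ### The invariant vector is nonzero -/

/-- The coefficient of `f_a ⊗ ⋯ ⊗ f_a` in a symmetric tensor. -/
def diagCoeff (n : ℕ) (a : Fin 2) : L n →ₗ[ℂ] ℂ :=
  (innerSL ℂ (elem fun _ : Fin n => f a)).toLinearMap ∘ₗ (symmetricTensors n).subtype

theorem diagCoeff_monomialVec {n : ℕ} (a : Fin 2) (k : ℕ) :
    diagCoeff n a (monomialVec n k)
      = ∏ i : Fin n, inner ℂ (f a) (if (i : ℕ) < k then f 0 else f 1) := by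
  rw [← inner_elem]
  exact inner_symProj ⟨elem fun _ => f a, fun σ => permute_elem σ _⟩ _

theorem inner_f (a b : Fin 2) : inner ℂ (f a) (f b) = if a = b then 1 else 0 := by
  rw [f, f, EuclideanSpace.inner_single_left]
  simp

theorem diagCoeff_zero_e {n k : ℕ} (hk : k ≤ n) :
    diagCoeff n 0 (e n k) = if k = n then 1 else 0 := by
  rw [e, map_smul, diagCoeff_monomialVec]
  split_ifs with h
  · subst h
    simp only [Fin.is_lt, if_true, inner_f, Finset.prod_const_one]
    simp [Nat.factorial_ne_zero]
  · rw [Finset.prod_eq_zero (Finset.mem_univ ⟨k, by omega⟩), smul_zero]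
    simp [inner_f]

theorem diagCoeff_one_e_zero (n : ℕ) : diagCoeff n 1 (e n 0) = 1 := by
  rw [e, map_smul, diagCoeff_monomialVec]
  simp only [Nat.not_lt_zero, if_false, inner_f, if_true, Finset.prod_const_one]
  simp [Nat.factorial_ne_zero]

/-- Pairing the left leg with f₀^{⊗ n} and the right leg with f₁^{⊗ n} kills every term except k =
n, leaving (n+1)^{-1/2}. -/
theorem delta_ne_zero (n : ℕ) : delta n ≠ 0 := by
  intro h
  have h' := congrArg (TensorProduct.lid ℂ ℂ ∘ TensorProduct.map (diagCoeff n 0) (diagCoeff n 1)) h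
  simp only [delta, Function.comp_apply, map_smul, map_sum, TensorProduct.map_tmul,
    TensorProduct.lid_tmul, map_zero] at h'
  rw [Finset.sum_eq_single_of_mem n (by simp)] at h'
  · rw [diagCoeff_zero_e le_rfl, Nat.sub_self, diagCoeff_one_e_zero] at h'
    have hn : Real.sqrt ((n : ℝ) + 1) ≠ 0 := by positivity
    simp [hn] at h'
  · intro k hk hkn
    rw [diagCoeff_zero_e (Nat.lt_succ_iff.1 (Finset.mem_range.1 hk)), if_neg hkn]
    simp

theorem map_mem_determinant {H : Type*} [NormedAddCommGroup H] [InnerProductSpace ℂ H] {n : ℕ}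
    {τ : SU2 →* (H ≃ₗᵢ[ℂ] H)} {V : L n ≃ₗᵢ[ℂ] H} (hV : Intertwines V τ) {ξ : L n ⊗[ℂ] L n}
    (hξ : ξ ∈ determinant (rho n)) :
    TensorProduct.map V.toLinearEquiv.toLinearMap V.toLinearEquiv.toLinearMap ξ
      ∈ determinant τ := by
  intro g
  have hcomm : toRep τ g ∘ₗ V.toLinearEquiv.toLinearMap
      = V.toLinearEquiv.toLinearMap ∘ₗ toRep (rho n) g :=
    LinearMap.ext fun x => (hV g x).symm
  rw [← LinearMap.comp_apply, ← TensorProduct.map_comp, hcomm, TensorProduct.map_comp,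
    LinearMap.comp_apply, hξ g]

end SUTwo

end

theorem propositionp {H : Type*} [NormedAddCommGroup H] [InnerProductSpace ℂ H]
    [FiniteDimensional ℂ H] (n : ℕ) (hdim : Module.finrank ℂ H = n + 1)
    (τ : SUTwo.SU2 →* (H ≃ₗᵢ[ℂ] H)) (hcont : SUTwo.IsStronglyContinuous τ)
    (hirr : SUTwo.IsIrreducible τ) :
    Module.finrank ℂ (SUTwo.determinant τ) = 1 ∧
      ∀ V : SUTwo.L n ≃ₗᵢ[ℂ] H, SUTwo.Intertwines V τ →
        SUTwo.determinant τ =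
          Submodule.span ℂ {TensorProduct.map V.toLinearEquiv.toLinearMap
            V.toLinearEquiv.toLinearMap (SUTwo.delta n)} := by
  refine ⟨SUTwo.finrank_determinant hcont hirr, fun V hV => ?_⟩
  have hmem := SUTwo.map_mem_determinant hV (SUTwo.delta_mem_determinant n)
  refine (Submodule.eq_of_le_of_finrank_eq ((Submodule.span_singleton_le_iff_mem _ _).2 hmem) ?_).symm
  rw [SUTwo.finrank_determinant hcont hirr]
  refine finrank_span_singleton fun h => SUTwo.delta_ne_zero n ?_
  -- V ⊗ V is a linear equivalence, so it cannot kill the nonzero `delta`.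
  exact (TensorProduct.congr V.toLinearEquiv V.toLinearEquiv).map_eq_zero_iff.1 h
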